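/- There are absolute constants $c>0$ and $C>0$ such that the following holds. **Model.** Let $A\in\mathbb{R}^{n\times n}$ be symmetric, $\bm h\in\mathbb{R}^n$, and let $\pi(\bm x)\propto \exp(\frac12 \bm x^TA\bm x+\bm h^T\bm x)$ be the corresponding Ising model on $\{-1,1\}^n$. Assume that for parameters $d,\lambda,\alpha>0$ (with $d$ an integer) and every $i\in[n]$: at most $d$ indices $k\ne i$ satisfy $A_{ik}\neq 0$; $\sum_{k\neq i}|A_{ik}|+|h_i|\le\lambda$; and $|A_{ik}|\ge\alpha$ whenever $k\ne i$ and $A_{ik}\ne 0$. **Chain.** For each $i\in[n]$ let $\mathsf P_i$ be a stochastic matrix on $\{-1,1\}^n$ that changes only the coordinate $i$. Write $\bm x^{i\mapsto\sigma}$ for $\bm x$ with $i$-th coordinate reset to $\sigma$, and $\bm x^{\oplus i}$ for $\bm x$ with $i$-th coordinate flipped. Assume the following. 1. (Reversibility) $\pi(\bm x)\mathsf P_i(\bm x,\bm x^{\oplus i})=\mathsf P_i(\bm x^{\oplus i},\bm x)\pi(\bm x^{\oplus i})$ for all $i,\bm x$. 2. (Site-consistency) There are nondecreasing $f_i:\mathbb{R}_+\to[0,1]$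 with $\mathsf P_i(\bm x^{i\mapsto-1},\bm x^{i\mapsto+1})=f_i\big(\pi(\bm x^{i\mapsto+1})/\pi(\bm x^{i\mapsto-1})\big)$ for all $i,\bm x$. 3. (Stability) With $g_i(z)=f_i(z)^2/z$, the chain is $(\lambda,\alpha,\delta_0,\eta)$-stable, where $\alpha\le\lambda$, $\delta_0\in\mathbb{R}$ and $\eta:[0,1]\to\mathbb{R}_+$ is nondecreasing with $\eta(0)=0$: for all $i$ and all $\beta\ge\alpha$ there is a unique $z^*>0$ with $g_i(z^*)=g_i(e^{\beta}z^*)$; and for every $\delta\in[0,1]$ with $\delta\le\delta_0$ and every $z\in[e^{-2\lambda},e^{2\lambda}]$, if $|g_i(z)-g_i(e^{\beta}z)|\le\delta$ then $|z^*-z|\le\eta(\delta)$. 4. ($\gamma$-boundedness, for some $\gamma\ge0$) For all $i$, all $\bm x,\bm y$ with $x_i=y_i$ and all $\sigma\in\{-1,1\}$, $\mathsf P_i(\bm x,\bm x^{i\mapsto\sigma})\le\exp\big(\gamma\sum_{k:x_k\ne y_k}|A_{ik}|\big)\,\mathsf P_i(\bm y,\bm y^{i\mapsto\sigma})$. 5.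 For some $\kappa>0$, $\mathsf P_i(\bm x,\bm x^{\oplus i})\ge\kappa$ for all $i,\bm x$. Each site carries an independent Poisson clock of rate $1$, at whose rings $\mathsf P_i$ is applied; that is, the chain has generator $\mathcal L=\sum_{i=1}^n(\mathsf P_i-I)$ and transition matrices $H_t=\exp(t\mathcal L)$. **Conclusion.** For all $i\ne j$ in $[n]$ and every $t\ge1$ (in particular for $t=1$): (a) There is a sub-transition kernel $Q_{ij}$ on $\{-1,1\}^n$ (nonnegative entries, row sums at most $1$) such that $H_t(\bm x,\bm y)\ge Q_{ij}(\bm x,\bm y)$ for all $\bm x,\bm y\in\{-1,1\}^n$; for all $\bm x\in\{-1,1\}^n$, $\bm y\in\{-1,1\}^{[n]\setminus\{i,j\}}$ and $\bm b,\bm b'\in\{-1,1\}^{\{i,j\}}$, $$Q_{ij}(\bm x,(\bm y,\bm b))\ \ge\ c\,e^{-C\gamma\lambda}\,\kappa^4\,Q_{ij}(\bm x,(\bm y,\bm b'));$$ and $\sum_{\bm y}Q_{ij}(\bm x,\bm y)\ge c$ for all $\bm x\in\{-1,1\}^n$. (b) For every probability distribution $\mathcal D$ on $\{-1,1\}^n$,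 if $X^0\sim\mathcal D$ and $P$ denotes the law $\mathcal D H_t$ of $X^t$, there is a sub-distribution $Q'_{ij}$ on $\{-1,1\}^n$ (nonnegative, total mass at most $1$) such that $P(X^t=\bm y)\ge Q'_{ij}(\bm y)$ for all $\bm y\in\{-1,1\}^n$; $Q'_{ij}((\bm y,\bm b))\ge c\,e^{-C\gamma\lambda}\kappa^4\,Q'_{ij}((\bm y,\bm b'))$ for all $\bm y\in\{-1,1\}^{[n]\setminus\{i,j\}}$ and $\bm b,\bm b'\in\{-1,1\}^{\{i,j\}}$; and $\sum_{\bm y}Q'_{ij}(\bm y)\ge c$. -/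

import Mathlib

namespace IsingDynamics

/-- Spin configurations in `{-1, 1}^n`; the spins are the two units of `ℤ`. -/
abbrev Config (n : ℕ) : Type := Fin n → ℤˣ

/-- The real value `±1` of the spin at site `i`. -/
def spin {n : ℕ} (x : Config n) (i : Fin n) : ℝ := ((x i : ℤ) : ℝ)

/-- The configuration `x^{i ↦ a}`, where the value at `i` is reset to `a`. -/
def setSite {n : ℕ} (x : Config n) (i : Fin n) (a : ℤˣ) : Config n := Function.update x i a

/-- The configuration `x^{⊕ i}`, where the spin at `i` is flipped. -/
def flip {n : ℕ} (x : Config n) (i : Fin n) : Config n := setSite x i (-(x i))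

/-- The configuration `(y, b)` with `b = (a, b)` placed at the sites `i, j` and with the values of
`y` at all other sites (the values of `y` at `i` and `j` are overwritten). -/
def setPair {n : ℕ} (y : Config n) (i j : Fin n) (a b : ℤˣ) : Config n :=
  setSite (setSite y i a) j b

/-- The exponent `(1/2) xᵀ A x + hᵀ x`. -/
noncomputable def energy {n : ℕ} (A : Matrix (Fin n) (Fin n) ℝ) (h : Fin n → ℝ)
    (x : Config n) : ℝ :=
  (1 / 2) * ∑ i, ∑ j, spin x i * A i j * spin x j + ∑ i, h i * spin x i

/-- The Ising model `π_{A,h}`. -/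
noncomputable def gibbs {n : ℕ} (A : Matrix (Fin n) (Fin n) ℝ) (h : Fin n → ℝ)
    (x : Config n) : ℝ :=
  Real.exp (energy A h x) / ∑ y : Config n, Real.exp (energy A h y)

/-- The nondegeneracy conditions on an Ising model, with parameters `d, lam, α > 0`: bounded
degree, bounded width, and a lower bound on the nonzero interactions. The diagonal of `A` does not
influence `π_{A,h}` and is not constrained. -/
structure IsingAssumption {n : ℕ} (A : Matrix (Fin n) (Fin n) ℝ) (h : Fin n → ℝ)
    (d : ℕ) (lam α : ℝ) : Prop where
  symm : A.IsSymm
  d_pos : 0 < d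
  lam_pos : 0 < lam
  α_pos : 0 < α
  degree : ∀ i, (Finset.univ.filter (fun k => k ≠ i ∧ A i k ≠ 0)).card ≤ d
  width : ∀ i, ∑ k ∈ Finset.univ.erase i, |A i k| + |h i| ≤ lam
  nondegenerate : ∀ i j, i ≠ j → A i j ≠ 0 → α ≤ |A i j|

/-- A family of single-site transition kernels: `P i` is a stochastic matrix on `{-1, 1}^n` which
only changes the spin at the site `i`. -/
structure IsSingleSite {n : ℕ} (P : Fin n → Matrix (Config n) (Config n) ℝ) : Prop where
  nonneg : ∀ i x y, 0 ≤ P i x y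
  row_sum : ∀ i x, ∑ y, P i x y = 1
  single_site : ∀ i x y, (∃ k, k ≠ i ∧ y k ≠ x k) → P i x y = 0

/-- Detailed balance of the single-site kernels with respect to `π`. -/
def IsReversible {n : ℕ} (P : Fin n → Matrix (Config n) (Config n) ℝ) (π : Config n → ℝ) : Prop :=
  ∀ i x, π x * P i x (flip x i) = P i (flip x i) x * π (flip x i)

/-- Site-consistency with respect to `π`, witnessed by the functions `f i : ℝ₊ → [0, 1]` (their
values on the negative reals are irrelevant). -/
structure IsSiteConsistent {n : ℕ} (P : Fin n → Matrix (Config n) (Config n) ℝ)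
    (π : Config n → ℝ) (f : Fin n → ℝ → ℝ) : Prop where
  mono : ∀ i, MonotoneOn (f i) (Set.Ici 0)
  mapsTo : ∀ i, Set.MapsTo (f i) (Set.Ici 0) (Set.Icc 0 1)
  eq : ∀ i x, P i (setSite x i (-1)) (setSite x i 1) =
    f i (π (setSite x i 1) / π (setSite x i (-1)))

/-- `(lam, α₀, δ₀, η)`-stability of the functions `f i` that witness site-consistency, where
`g i z = f i z ^ 2 / z` for `z > 0` and `η : [0, 1] → ℝ₊`. -/
structure IsStable {n : ℕ} (f : Fin n → ℝ → ℝ) (lam α₀ δ₀ : ℝ) (η : ℝ → ℝ) : Prop where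
  α_pos : 0 < α₀
  α_le : α₀ ≤ lam
  η_mono : MonotoneOn η (Set.Icc 0 1)
  η_nonneg : ∀ δ ∈ Set.Icc (0 : ℝ) 1, 0 ≤ η δ
  η_zero : η 0 = 0
  stable : ∀ i, ∀ α, α₀ ≤ α → ∃ zs : ℝ, 0 < zs ∧
    f i zs ^ 2 / zs = f i (Real.exp α * zs) ^ 2 / (Real.exp α * zs) ∧
    (∀ z, 0 < z → f i z ^ 2 / z = f i (Real.exp α * z) ^ 2 / (Real.exp α * z) → z = zs) ∧
    ∀ δ ∈ Set.Icc (0 : ℝ) 1, δ ≤ δ₀ →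
      ∀ z ∈ Set.Icc (Real.exp (-2 * lam)) (Real.exp (2 * lam)),
        |f i z ^ 2 / z - f i (Real.exp α * z) ^ 2 / (Real.exp α * z)| ≤ δ → |zs - z| ≤ η δ

/-- `γ`-boundedness. The bound on the ratio `P i x x^{i ↦ s} / P i y y^{i ↦ s}` is written without
division, so that a zero denominator forces a zero numerator. -/
def IsBounded {n : ℕ} (A : Matrix (Fin n) (Fin n) ℝ)
    (P : Fin n → Matrix (Config n) (Config n) ℝ) (γ : ℝ) : Prop :=
  ∀ (i : Fin n) (x y : Config n) (s : ℤˣ), x i = y i →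
    P i x (setSite x i s) ≤
      Real.exp (γ * ∑ k ∈ Finset.univ.filter (fun k => x k ≠ y k), |A i k|) *
        P i y (setSite y i s)

/-- The conditions on a single-site Markov chain (with unit-rate clocks at the sites) that is
reversible with respect to `π_{A,h}`. -/
structure ChainAssumption {n : ℕ} (A : Matrix (Fin n) (Fin n) ℝ) (h : Fin n → ℝ)
    (P : Fin n → Matrix (Config n) (Config n) ℝ) (lam α δ₀ : ℝ) (η : ℝ → ℝ) (γ κ : ℝ) : Prop where
  singleSite : IsSingleSite P
  reversible : IsReversible P (gibbs A h)
  consistent_stable : ∃ f : Fin n → ℝ → ℝ,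
    IsSiteConsistent P (gibbs A h) f ∧ IsStable f lam α δ₀ η
  γ_nonneg : 0 ≤ γ
  bounded : IsBounded A P γ
  κ_pos : 0 < κ
  flip_lower : ∀ i x, κ ≤ P i x (flip x i)

/-- The generator `∑ i, (P i - I)` of the continuous-time chain in which every site carries an
independent Poisson clock of rate one. -/
noncomputable def generator {n : ℕ} (P : Fin n → Matrix (Config n) (Config n) ℝ) :
    Matrix (Config n) (Config n) ℝ :=
  ∑ i, (P i - 1)

/-- The transition matrix `H_t = exp (t L)` of the continuous-time chain. -/
noncomputable def transition {n : ℕ} (P : Fin n → Matrix (Config n) (Config n) ℝ) (t : ℝ) :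
    Matrix (Config n) (Config n) ℝ :=
  NormedSpace.exp (t • generator P)

/-- The law of `X^t` when `X^0` has law `D`: the vector `y ↦ ∑ x, D x * H_t(x, y)`. -/
noncomputable def lawAt {n : ℕ} (P : Fin n → Matrix (Config n) (Config n) ℝ)
    (D : Config n → ℝ) (t : ℝ) : Config n → ℝ :=
  Matrix.vecMul D (transition P t)

/-- Sub-distributions: nonnegative with total mass at most one. -/
def IsSubDistribution {n : ℕ} (q : Config n → ℝ) : Prop :=
  (∀ y, 0 ≤ q y) ∧ ∑ y, q y ≤ 1

/-- For every outside configuration, the four settings of the spins at `i` and `j` have masses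
within the factor `r` of each other. -/
def IsLocallyStable {n : ℕ} (q : Config n → ℝ) (i j : Fin n) (r : ℝ) : Prop :=
  ∀ (y : Config n) (a b a' b' : ℤˣ),
    r * q (setPair y i j a' b') ≤ q (setPair y i j a b)

end IsingDynamics

open IsingDynamics

/-! Uniformization writes `transition P 1` as `exp (-n)` times the sum over all words `k₁ ⋯ kₘ` of
`P k₁ * ⋯ * P kₘ / m!`. Keep only the words that avoid `i` and `j`, which have total mass `exp
(-2)`, and give the letter `k` the weight `w k = |A k i| + |A k j|`. By width and symmetry the
expected weight is at most `2 * lam`, so by Markov's inequality words of weight at most `4 * lam`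
carry at least half of this mass (`le_sum_budgetKernel`). Along them the spins at `i` and `j` never
move.

To reach another setting of these two spins, insert a flip at `i`, at `j`, or both, into such a
word. Each flip costs a factor `κ`. By `γ`-boundedness, the remaining path, carried along with the
flipped spin, loses at most `exp (-(γ * s))` per flip for words of weight at most `s`
(`IsFlipStable.budgetSum_le`). The insertions give distinct words, as `i` and `j` are not letters of
the original one; there are `m + 1` of them for one flip and `(m + 2) * (m + 1)` for two, which
exactly offsets the passage from `1 / m!` to `1 / (m + 1)!` or `1 / (m + 2)!`
(`mul_budgetKernel_le_transition`). Hence the restricted kernel, spread to all four settings with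
the factor `κ ^ 2 * exp (-(8 * γ * lam))`, still lies below `transition P 1`.

For `t ≥ 1`, run the chain up to time `t - 1` and average the time-one kernel over the resulting
law: all the required inequalities are linear. -/

namespace IsingDynamics

open Finset Matrix

/-! ### Uniformization: the transition matrix as a Poisson mixture of jump words -/

section Kernels

variable {n : ℕ} {P : Fin n → Matrix (Config n) (Config n) ℝ}

/-- The sum of the single-site kernels, the jump matrix of the uniformized chain. -/
noncomputable def jump (P : Fin n → Matrix (Config n) (Config n) ℝ) :
    Matrix (Config n) (Config n) ℝ :=
  ∑ i, P i

lemma jump_pow_succ_apply (m : ℕ) (x y : Config n) :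
    (jump P ^ (m + 1)) x y = ∑ k, ∑ z, P k x z * (jump P ^ m) z y := by
  rw [pow_succ', Matrix.mul_apply, Finset.sum_comm]
  refine Finset.sum_congr rfl fun z _ => ?_
  rw [jump, Matrix.sum_apply, Finset.sum_mul]

lemma jump_pow_nonneg (hP : IsSingleSite P) (m : ℕ) (x y : Config n) :
    0 ≤ (jump P ^ m) x y := by
  induction m generalizing x with
  | zero => rw [pow_zero, Matrix.one_apply]; split_ifs <;> norm_num
  | succ m ih =>
    rw [jump_pow_succ_apply]
    exact Finset.sum_nonneg fun k _ => Finset.sum_nonneg fun z _ =>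
      mul_nonneg (hP.nonneg k x z) (ih z)

lemma sum_jump_pow (hP : IsSingleSite P) (m : ℕ) (x : Config n) :
    ∑ y, (jump P ^ m) x y = (n : ℝ) ^ m := by
  induction m generalizing x with
  | zero => simp [Matrix.one_apply]
  | succ m ih =>
    simp_rw [jump_pow_succ_apply]
    rw [Finset.sum_comm]
    have h : ∀ k : Fin n, ∑ y, ∑ z, P k x z * (jump P ^ m) z y = (n : ℝ) ^ m := by
      intro k
      rw [Finset.sum_comm]
      simp_rw [← Finset.mul_sum, ih, ← Finset.sum_mul, hP.row_sum, one_mul]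
    simp_rw [h]
    simp [pow_succ']

lemma hasSum_exp_apply {ι : Type*} [Fintype ι] [DecidableEq ι] (M : Matrix ι ι ℝ) (x y : ι) :
    HasSum (fun m : ℕ => (m.factorial : ℝ)⁻¹ * (M ^ m) x y) (NormedSpace.exp M x y) := by
  let _ : NormedRing (Matrix ι ι ℝ) := Matrix.linftyOpNormedRing
  let _ : NormedAlgebra ℝ (Matrix ι ι ℝ) := Matrix.linftyOpNormedAlgebra
  have h := NormedSpace.exp_series_hasSum_exp' (𝕂 := ℝ) M
  exact Pi.hasSum.1 (Pi.hasSum.1 h x) y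

/-- The generator is `jump P` minus `n` times the identity. The scalar part commutes with
everything, so the exponential splits into `exp (-(n * t))` and the power series of `t • jump P`. -/
lemma hasSum_transition (P : Fin n → Matrix (Config n) (Config n) ℝ) (t : ℝ) (x y : Config n) :
    HasSum (fun m : ℕ => Real.exp (-(n * t)) * ((m.factorial : ℝ)⁻¹ * (t ^ m * (jump P ^ m) x y)))
      (transition P t x y) := by
  have hg : t • generator P =
      Matrix.diagonal (fun _ => -(n * t)) + t • jump P := by
    have h1 : Matrix.diagonal (fun _ : Config n => -((n : ℝ) * t))
        = (-(n * t)) • (1 : Matrix (Config n) (Config n) ℝ) := by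
      rw [Matrix.smul_one_eq_diagonal]
    rw [h1, generator, jump, Finset.sum_sub_distrib, Finset.sum_const, Finset.card_univ,
      Fintype.card_fin, smul_sub, ← Nat.cast_smul_eq_nsmul ℝ, smul_smul]
    rw [neg_smul, mul_comm t]
    abel
  have hc : Commute (Matrix.diagonal (fun _ : Config n => -((n : ℝ) * t))) (t • jump P) := by
    rw [← Matrix.smul_one_eq_diagonal]
    exact (Commute.one_left _).smul_left _
  rw [transition, hg, Matrix.exp_add_of_commute _ _ hc, Matrix.exp_diagonal,
    Matrix.diagonal_mul]
  have h := (hasSum_exp_apply (t • jump P) x y).mul_left (Real.exp (-(n * t)))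
  have he : (NormedSpace.exp fun _ : Config n => -((n : ℝ) * t)) x = Real.exp (-(n * t)) := by
    rw [Pi.coe_exp, Real.exp_eq_exp_ℝ]
  rw [he]
  simpa only [smul_pow, Matrix.smul_apply, smul_eq_mul] using h

lemma transition_nonneg (hP : IsSingleSite P) {t : ℝ} (ht : 0 ≤ t) (x y : Config n) :
    0 ≤ transition P t x y :=
  (hasSum_transition P t x y).nonneg fun m => by
    have := jump_pow_nonneg hP m x y
    positivity

lemma sum_transition (hP : IsSingleSite P) (t : ℝ) (x : Config n) :
    ∑ y, transition P t x y = 1 := by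
  have h := hasSum_sum (s := Finset.univ) fun y _ => hasSum_transition P t x y
  simp_rw [← Finset.mul_sum, sum_jump_pow hP, ← mul_pow] at h
  have h2 : HasSum (fun m : ℕ => (m.factorial : ℝ)⁻¹ * (t * n) ^ m) (Real.exp (t * n)) := by
    rw [Real.exp_eq_exp_ℝ]
    simpa only [smul_eq_mul] using NormedSpace.exp_series_hasSum_exp' (𝕂 := ℝ) (t * (n : ℝ))
  rw [h.unique (h2.mul_left _), ← Real.exp_add, mul_comm t, neg_add_cancel, Real.exp_zero]

lemma transition_add (P : Fin n → Matrix (Config n) (Config n) ℝ) (s t : ℝ) :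
    transition P (s + t) = transition P s * transition P t := by
  rw [transition, add_smul, Matrix.exp_add_of_commute]
  · rfl
  · exact ((Commute.refl _).smul_left _).smul_right _

end Kernels

/-! ### Words of bounded weight and their mass -/

section Budget

variable {n : ℕ} {P : Fin n → Matrix (Config n) (Config n) ℝ} {U : Finset (Fin n)} {w : Fin n → ℝ}

/-- The sum of the products `P k₁ * ⋯ * P kₘ` over the words `k₁ ⋯ kₘ` with letters in `U` and
total weight `w k₁ + ⋯ + w kₘ` at most `s`. -/
noncomputable def budgetSum (P : Fin n → Matrix (Config n) (Config n) ℝ) (U : Finset (Fin n))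
    (w : Fin n → ℝ) : ℕ → ℝ → Matrix (Config n) (Config n) ℝ
  | 0, s => if 0 ≤ s then 1 else 0
  | m + 1, s => ∑ k ∈ U, P k * budgetSum P U w m (s - w k)

lemma budgetSum_succ_apply (m : ℕ) (s : ℝ) (x y : Config n) :
    budgetSum P U w (m + 1) s x y =
      ∑ k ∈ U, ∑ z, P k x z * budgetSum P U w m (s - w k) z y := by
  rw [budgetSum, Matrix.sum_apply]
  rfl

lemma budgetSum_zero_apply (s : ℝ) (x y : Config n) :
    budgetSum P U w 0 s x y = if 0 ≤ s ∧ x = y then 1 else 0 := by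
  rw [budgetSum]
  split_ifs with h1 h2 h2
  · rw [h2.2, Matrix.one_apply_eq]
  · exact Matrix.one_apply_ne fun h => h2 ⟨h1, h⟩
  · exact absurd h2.1 h1
  · rfl

lemma budgetSum_nonneg (hP : IsSingleSite P) (m : ℕ) (s : ℝ) (x y : Config n) :
    0 ≤ budgetSum P U w m s x y := by
  induction m generalizing s x with
  | zero => rw [budgetSum_zero_apply]; split_ifs <;> norm_num
  | succ m ih =>
    rw [budgetSum_succ_apply]
    exact Finset.sum_nonneg fun k _ => Finset.sum_nonneg fun z _ =>
      mul_nonneg (hP.nonneg k x z) (ih _ z)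

lemma budgetSum_le_jump_pow (hP : IsSingleSite P) (m : ℕ) (s : ℝ) (x y : Config n) :
    budgetSum P U w m s x y ≤ (jump P ^ m) x y := by
  induction m generalizing s x with
  | zero =>
    rw [budgetSum_zero_apply, pow_zero, Matrix.one_apply]
    split_ifs with h1 h2 h2
    · exact le_rfl
    · exact absurd h1.2 h2
    · exact zero_le_one
    · exact le_rfl
  | succ m ih =>
    rw [budgetSum_succ_apply, jump_pow_succ_apply]
    refine le_trans (Finset.sum_le_sum fun k _ => Finset.sum_le_sum fun z _ =>
      mul_le_mul_of_nonneg_left (ih _ z) (hP.nonneg k x z)) ?_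
    exact Finset.sum_le_sum_of_subset_of_nonneg (Finset.subset_univ U) fun k _ _ =>
      Finset.sum_nonneg fun z _ => mul_nonneg (hP.nonneg k x z) (jump_pow_nonneg hP m z y)

lemma budgetSum_eq_zero_of_ne (hP : IsSingleSite P) {i : Fin n} (hi : i ∉ U) {x y : Config n}
    (hxy : y i ≠ x i) (m : ℕ) (s : ℝ) : budgetSum P U w m s x y = 0 := by
  induction m generalizing s x with
  | zero =>
    rw [budgetSum_zero_apply, if_neg]
    rintro ⟨-, rfl⟩
    exact hxy rfl
  | succ m ih =>
    rw [budgetSum_succ_apply]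
    refine Finset.sum_eq_zero fun k hk => Finset.sum_eq_zero fun z _ => ?_
    by_cases hz : z i = x i
    · rw [ih (hz ▸ hxy), mul_zero]
    · rw [hP.single_site k x z ⟨i, fun h => hi (h ▸ hk), hz⟩, zero_mul]

/-- A Markov inequality: the words of weight more than `s` have a small share of the total mass. -/
lemma le_sum_budgetSum (hP : IsSingleSite P) (hw : ∀ k, 0 ≤ w k) {S : ℝ} (m : ℕ)
    (s : ℝ) (hs : s ≤ S) (x : Config n) :
    (#U : ℝ) ^ m * s - m * (#U : ℝ) ^ (m - 1) * ∑ k ∈ U, w k ≤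
      S * ∑ y, budgetSum P U w m s x y := by
  induction m generalizing s x with
  | zero =>
    -- The empty word is over budget when `s < 0`; the right side is then `0` and the left side is
    -- `s`. The constant `S` stays fixed while the budget `s` shrinks along the recursion, so only
    -- `s ≤ S` is available for `0 ≤ s`.
    by_cases h : 0 ≤ s
    · simpa [budgetSum_zero_apply, h] using hs
    · simpa [budgetSum_zero_apply, h] using (not_le.1 h).le
  | succ m ih =>
    have h : ∀ k ∈ U, (#U : ℝ) ^ m * (s - w k) - m * (#U : ℝ) ^ (m - 1) * ∑ l ∈ U, w l ≤
        S * ∑ y, ∑ z, P k x z * budgetSum P U w m (s - w k) z y := by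
      intro k _
      generalize ∑ l ∈ U, w l = a at ih ⊢
      calc _ = ∑ z, P k x z * ((#U : ℝ) ^ m * (s - w k) - m * (#U : ℝ) ^ (m - 1) * a) := by
            rw [← Finset.sum_mul, hP.row_sum, one_mul]
        _ ≤ ∑ z, P k x z * (S * ∑ y, budgetSum P U w m (s - w k) z y) :=
            Finset.sum_le_sum fun z _ => mul_le_mul_of_nonneg_left
              (ih _ (by linarith [hw k]) z) (hP.nonneg k x z)
        _ = _ := by
            rw [Finset.sum_comm, Finset.mul_sum]
            refine Finset.sum_congr rfl fun z _ => ?_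
            rw [← Finset.mul_sum, mul_left_comm]
    have hcomm : ∑ y, budgetSum P U w (m + 1) s x y =
        ∑ k ∈ U, ∑ y, ∑ z, P k x z * budgetSum P U w m (s - w k) z y := by
      simp_rw [budgetSum_succ_apply]
      exact Finset.sum_comm
    rw [hcomm, Finset.mul_sum U _ S]
    refine le_trans (le_of_eq ?_) (Finset.sum_le_sum h)
    rw [Finset.sum_sub_distrib, ← Finset.mul_sum U, Finset.sum_sub_distrib, Finset.sum_const,
      Finset.sum_const, nsmul_eq_mul, nsmul_eq_mul]
    -- The truncated exponent `m - 1` is harmless at `m = 0`, where its coefficient vanishes.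
    rcases m with _ | m
    · simp
    · simp only [Nat.add_sub_cancel]
      push_cast
      ring

end Budget

/-! ### Inserting flips at `i` and `j` into words that avoid them -/

section Insertion

variable {n : ℕ} {P : Fin n → Matrix (Config n) (Config n) ℝ} {U : Finset (Fin n)} {w : Fin n → ℝ}
  {γ κ : ℝ} {i j : Fin n}

/-- The configuration whose only negative spin is at `i`; multiplying by it flips the spin at
`i`. -/
def negAt (i : Fin n) : Config n := Pi.mulSingle i (-1)

lemma negAt_mul (i : Fin n) (x : Config n) : negAt i * x = flip x i := by
  funext k
  rcases eq_or_ne k i with rfl | h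
  · simp [negAt, flip, setSite]
  · simp [negAt, flip, setSite, h]

/-- Multiplication by `ε` decreases the entries of the kernels `P k`, `k ∈ U`, at most by the
factor `exp (-(γ * w k))`. -/
def IsFlipStable (P : Fin n → Matrix (Config n) (Config n) ℝ) (U : Finset (Fin n))
    (w : Fin n → ℝ) (γ : ℝ) (ε : Config n) : Prop :=
  ∀ k ∈ U, ∀ x y, Real.exp (-(γ * w k)) * P k x y ≤ P k (ε * x) (ε * y)

/-- Multiply every configuration on the path by `ε`. A step with letter `k` loses at most `exp (-(γ
* w k))`, and these losses multiply to at least `exp (-(γ * s))` because the total weight is at most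
`s`. -/
lemma IsFlipStable.budgetSum_le {ε : Config n} (hε : IsFlipStable P U w γ ε)
    (hP : IsSingleSite P) (hγ : 0 ≤ γ) (m : ℕ) (s : ℝ) (x y : Config n) :
    Real.exp (-(γ * s)) * budgetSum P U w m s x y ≤ budgetSum P U w m s (ε * x) (ε * y) := by
  induction m generalizing s x with
  | zero =>
    simp_rw [budgetSum_zero_apply, mul_right_inj]
    split_ifs with h
    · rw [mul_one, Real.exp_le_one_iff, neg_nonpos]
      exact mul_nonneg hγ h.1
    · rw [mul_zero]
  | succ m ih =>
    simp_rw [budgetSum_succ_apply]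
    rw [Finset.mul_sum]
    refine Finset.sum_le_sum fun k hk => ?_
    rw [Finset.mul_sum, ← Equiv.sum_comp (Equiv.mulLeft ε)
      (fun z => P k (ε * x) z * budgetSum P U w m (s - w k) z (ε * y))]
    refine Finset.sum_le_sum fun z _ => ?_
    have h := mul_le_mul (hε k hk x z) (ih (s - w k) z)
      (mul_nonneg (Real.exp_pos _).le (budgetSum_nonneg hP _ _ _ _)) (hP.nonneg _ _ _)
    refine le_trans (le_of_eq ?_) h
    have he : Real.exp (-(γ * s)) = Real.exp (-(γ * w k)) * Real.exp (-(γ * (s - w k))) := by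
      rw [← Real.exp_add]; congr 1; ring
    rw [he]; ring

/-- Split by the first letter: the words starting with `i`, restricted to an actual flip, are
disjoint from those starting in `U`. This is the recursion that counts insertions. -/
lemma add_le_jump_pow_succ (hP : IsSingleSite P) (hi : i ∉ U)
    (hκ : ∀ x, κ ≤ P i x (flip x i)) (m : ℕ) (x y : Config n) :
    κ * (jump P ^ m) (negAt i * x) y + ∑ k ∈ U, ∑ z, P k x z * (jump P ^ m) z y ≤
      (jump P ^ (m + 1)) x y := by
  have hnn : ∀ k z, 0 ≤ P k x z * (jump P ^ m) z y := fun k z =>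
    mul_nonneg (hP.nonneg k x z) (jump_pow_nonneg hP m z y)
  rw [jump_pow_succ_apply]
  refine le_trans (add_le_add ?_ le_rfl) ((Finset.sum_insert hi).symm.le.trans
    (Finset.sum_le_sum_of_subset_of_nonneg (Finset.subset_univ (insert i U)) fun k _ _ =>
      Finset.sum_nonneg fun z _ => hnn k z))
  refine le_trans ?_ (Finset.single_le_sum (f := fun z => P i x z * (jump P ^ m) z y)
    (fun z _ => hnn i z) (Finset.mem_univ (flip x i)))
  rw [negAt_mul]
  exact mul_le_mul_of_nonneg_right (hκ x) (jump_pow_nonneg hP m _ y)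

/-- The step in which the first letter of a word lies in `U`. -/
lemma mul_budgetSum_succ_le (hP : IsSingleSite P) {r δ : ℝ} {p m : ℕ} {ε y : Config n} (hr : 0 ≤ r)
    (hδ : 0 ≤ δ) (hw : ∀ k, 0 ≤ w k)
    (h : ∀ s z, r * Real.exp (-(δ * s)) * budgetSum P U w m s z y ≤ (jump P ^ p) z (ε * y))
    (s : ℝ) (x : Config n) :
    r * Real.exp (-(δ * s)) * budgetSum P U w (m + 1) s x y ≤
      ∑ k ∈ U, ∑ z, P k x z * (jump P ^ p) z (ε * y) := by
  rw [budgetSum_succ_apply, Finset.mul_sum]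
  refine Finset.sum_le_sum fun k _ => ?_
  rw [Finset.mul_sum]
  refine Finset.sum_le_sum fun z _ => ?_
  rw [mul_left_comm]
  refine mul_le_mul_of_nonneg_left (le_trans ?_ (h (s - w k) z)) (hP.nonneg k x z)
  refine mul_le_mul_of_nonneg_right (mul_le_mul_of_nonneg_left (Real.exp_le_exp.2 ?_) hr)
    (budgetSum_nonneg hP _ _ _ _)
  nlinarith [mul_nonneg hδ (hw k)]

/-- One flip at `i`, inserted at any of the `m + 1` positions of a word of length `m`. -/
lemma le_jump_pow_succ_negAt_mul (hP : IsSingleSite P) (hw : ∀ k, 0 ≤ w k) (hγ : 0 ≤ γ)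
    (hκ0 : 0 ≤ κ) (hi : i ∉ U) (hκ : ∀ x, κ ≤ P i x (flip x i))
    (hf : IsFlipStable P U w γ (negAt i)) (m : ℕ) (s : ℝ) (x y : Config n) :
    (m + 1) * κ * Real.exp (-(γ * s)) * budgetSum P U w m s x y ≤
      (jump P ^ (m + 1)) x (negAt i * y) := by
  -- The contribution of the flip inserted in front of the whole word.
  have key : ∀ m s x, κ * Real.exp (-(γ * s)) * budgetSum P U w m s x y ≤
      κ * (jump P ^ m) (negAt i * x) (negAt i * y) := fun m s x => by
    rw [mul_assoc]
    exact mul_le_mul_of_nonneg_left ((hf.budgetSum_le hP hγ m s x y).trans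
      (budgetSum_le_jump_pow hP _ _ _ _)) hκ0
  induction m generalizing s x with
  | zero =>
    refine le_trans ?_ (add_le_jump_pow_succ hP hi hκ 0 x (negAt i * y))
    refine le_add_of_le_of_nonneg ?_ (Finset.sum_nonneg fun k _ => Finset.sum_nonneg fun z _ =>
      mul_nonneg (hP.nonneg k x z) (jump_pow_nonneg hP _ _ _))
    simpa using key 0 s x
  | succ m ih =>
    refine le_trans ?_ (add_le_jump_pow_succ hP hi hκ (m + 1) x (negAt i * y))
    -- The flip comes either after the first letter (`m + 1` positions, by induction) or before it
    -- (one position), which gives `m + 2`.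
    have h1 := mul_budgetSum_succ_le hP (by positivity) hγ hw ih s x
    have h2 := key (m + 1) s x
    push_cast
    linarith

/-- Two flips, at `i` and at `j`, inserted in any of the `(m + 2) (m + 1)` possible ways. -/
lemma le_jump_pow_add_two_negAt_mul (hP : IsSingleSite P) (hw : ∀ k, 0 ≤ w k) (hγ : 0 ≤ γ)
    (hκ0 : 0 ≤ κ) (hij : i ≠ j) (hi : i ∉ U) (hj : j ∉ U) (hκ : ∀ k x, κ ≤ P k x (flip x k))
    (hfi : IsFlipStable P U w γ (negAt i)) (hfj : IsFlipStable P U w γ (negAt j))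
    (m : ℕ) (s : ℝ) (x y : Config n) :
    (m + 2) * (m + 1) * κ ^ 2 * Real.exp (-(2 * γ * s)) * budgetSum P U w m s x y ≤
      (jump P ^ (m + 2)) x (negAt i * negAt j * y) := by
  -- The flip at `i` comes first, and the flip at `j` has `m + 1` possible positions in the rest.
  -- Each flip contributes one factor `exp (-(γ * s))`.
  have step : ∀ {i j : Fin n}, j ∉ U → IsFlipStable P U w γ (negAt i) →
      IsFlipStable P U w γ (negAt j) → ∀ (m : ℕ) s x,
      (m + 1) * κ ^ 2 * Real.exp (-(2 * γ * s)) * budgetSum P U w m s x y ≤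
        κ * (jump P ^ (m + 1)) (negAt i * x) (negAt i * negAt j * y) := by
    intro i j hj hfi hfj m s x
    have h1 := le_jump_pow_succ_negAt_mul hP hw hγ hκ0 hj (hκ j) hfj m s (negAt i * x)
      (negAt i * y)
    rw [mul_left_comm (negAt j), ← mul_assoc (negAt i)] at h1
    refine le_trans (le_of_eq ?_) (mul_le_mul_of_nonneg_left ((mul_le_mul_of_nonneg_left
      (hfi.budgetSum_le hP hγ m s x y) (by positivity)).trans h1) hκ0)
    have he : Real.exp (-(2 * γ * s)) = Real.exp (-(γ * s)) * Real.exp (-(γ * s)) := by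
      rw [← Real.exp_add]; congr 1; ring
    rw [he]; ring
  have hsucc : ∀ m x, κ * (jump P ^ m) (negAt i * x) (negAt i * negAt j * y) +
      κ * (jump P ^ m) (negAt j * x) (negAt i * negAt j * y) +
      ∑ k ∈ U, ∑ z, P k x z * (jump P ^ m) z (negAt i * negAt j * y) ≤
      (jump P ^ (m + 1)) x (negAt i * negAt j * y) := by
    intro m x
    have hi' : i ∉ insert j U := by simp [hij, hi]
    refine le_trans ?_ (add_le_jump_pow_succ hP hi' (hκ i) m x _)
    rw [Finset.sum_insert hj, add_assoc]
    gcongr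
    refine le_trans ?_ (Finset.single_le_sum (f := fun z => P j x z * (jump P ^ m) z _)
      (fun z _ => mul_nonneg (hP.nonneg j x z) (jump_pow_nonneg hP m z _))
      (Finset.mem_univ (flip x j)))
    rw [negAt_mul]
    exact mul_le_mul_of_nonneg_right (hκ j x) (jump_pow_nonneg hP m _ _)
  have hi1 := step (i := i) (j := j) hj hfi hfj
  have hj1 := step (i := j) (j := i) hi hfj hfi
  rw [mul_comm (negAt j)] at hj1
  induction m generalizing s x with
  | zero =>
    have h1 := hi1 0 s x
    have h2 := hj1 0 s x
    refine le_trans ?_ (hsucc 1 x)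
    refine le_add_of_le_of_nonneg ?_ (Finset.sum_nonneg fun k _ => Finset.sum_nonneg fun z _ =>
      mul_nonneg (hP.nonneg k x z) (jump_pow_nonneg hP _ _ _))
    simp only [Nat.cast_zero, zero_add] at h1 h2 ⊢
    linarith
  | succ m ih =>
    refine le_trans ?_ (hsucc (m + 2) x)
    -- A flip at `i` or at `j` in front gives `m + 2` insertions each, and a first letter in `U`
    -- gives `(m + 2) * (m + 1)` by induction; the total is `(m + 3) * (m + 2)`.
    have h1 := hi1 (m + 1) s x
    have h2 := hj1 (m + 1) s x
    have h3 := mul_budgetSum_succ_le hP (by positivity) (by positivity : 0 ≤ 2 * γ) hw ih s x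
    push_cast at h1 h2 ⊢
    linarith

/-! ### From words to kernels at time one -/

/-- The part of `transition P 1` that comes from jump sequences with letters in `U` and weight at
most `s`. -/
noncomputable def budgetKernel (P : Fin n → Matrix (Config n) (Config n) ℝ) (U : Finset (Fin n))
    (w : Fin n → ℝ) (s : ℝ) : Matrix (Config n) (Config n) ℝ :=
  fun x y => Real.exp (-n) * ∑' m : ℕ, (m.factorial : ℝ)⁻¹ * budgetSum P U w m s x y

lemma hasSum_transition_one (P : Fin n → Matrix (Config n) (Config n) ℝ) (x y : Config n) :
    HasSum (fun m : ℕ => Real.exp (-n) * ((m.factorial : ℝ)⁻¹ * (jump P ^ m) x y))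
      (transition P 1 x y) := by
  simpa using hasSum_transition P 1 x y

lemma hasSum_budgetKernel (hP : IsSingleSite P) (s : ℝ) (x y : Config n) :
    HasSum (fun m : ℕ => Real.exp (-n) * ((m.factorial : ℝ)⁻¹ * budgetSum P U w m s x y))
      (budgetKernel P U w s x y) := by
  refine HasSum.mul_left _ (Summable.hasSum ?_)
  have h := (summable_mul_left_iff (Real.exp_pos (-(n : ℝ))).ne').1
    (hasSum_transition_one P x y).summable
  refine Summable.of_nonneg_of_le (fun m => ?_) (fun m => ?_) h
  · exact mul_nonneg (by positivity) (budgetSum_nonneg hP _ _ _ _)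
  · exact mul_le_mul_of_nonneg_left (budgetSum_le_jump_pow hP _ _ _ _) (by positivity)

lemma budgetKernel_nonneg (hP : IsSingleSite P) (s : ℝ) (x y : Config n) :
    0 ≤ budgetKernel P U w s x y :=
  (hasSum_budgetKernel hP s x y).nonneg fun m => mul_nonneg (Real.exp_pos _).le
    (mul_nonneg (by positivity) (budgetSum_nonneg hP _ _ _ _))

lemma budgetKernel_eq_zero_of_ne (hP : IsSingleSite P) (hi : i ∉ U) {x y : Config n}
    (hxy : y i ≠ x i) (s : ℝ) : budgetKernel P U w s x y = 0 := by
  have h := hasSum_budgetKernel (U := U) (w := w) hP s x y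
  simp only [budgetSum_eq_zero_of_ne hP hi hxy, mul_zero] at h
  exact h.unique hasSum_zero

/-- Compare the term `m` of the restricted series with the term `m + p` of the full one. The number
of ways to insert `p` distinct flips is `(m + p)! / m!`, so the factorials cancel and no factor
depending on `m` is lost. -/
lemma mul_budgetKernel_le_transition (hP : IsSingleSite P) {r s : ℝ} {x y y' : Config n} (p : ℕ)
    (h : ∀ m : ℕ, r * (m + p).descFactorial p * budgetSum P U w m s x y ≤
      (jump P ^ (m + p)) x y') :
    r * budgetKernel P U w s x y ≤ transition P 1 x y' := by
  refine hasSum_le_inj (fun m => m + p) (add_left_injective p) (fun m _ => ?_) (fun m => ?_)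
    ((hasSum_budgetKernel hP s x y).mul_left r) (hasSum_transition_one P x y')
  · exact mul_nonneg (Real.exp_pos _).le (mul_nonneg (by positivity) (jump_pow_nonneg hP _ _ _))
  · have hfac : ((m + p).factorial : ℝ) = m.factorial * (m + p).descFactorial p := by
      rw [← Nat.cast_mul, ← Nat.factorial_mul_descFactorial (Nat.le_add_left p m),
        Nat.add_sub_cancel]
    have hp : ((m + p).descFactorial p : ℝ) ≠ 0 := by
      rw [Nat.cast_ne_zero, Ne, Nat.descFactorial_eq_zero_iff_lt]
      omega
    rw [mul_left_comm]
    refine mul_le_mul_of_nonneg_left (le_trans (le_of_eq ?_)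
      (mul_le_mul_of_nonneg_left (h m) (by positivity))) (Real.exp_pos _).le
    rw [hfac]
    field_simp

/-- Markov's inequality summed over the word length: `exp (-(n - #U))` is the probability that no
clock outside `U` rings in unit time, and `∑ k ∈ U, w k` is the expected weight, as each clock in
`U` rings once on average. -/
lemma le_sum_budgetKernel (hP : IsSingleSite P) (hw : ∀ k, 0 ≤ w k) (s : ℝ) (x : Config n) :
    Real.exp (-(n - #U : ℝ)) * (s - ∑ k ∈ U, w k) ≤ s * ∑ y, budgetKernel P U w s x y := by
  set b : ℝ := (#U : ℝ)
  set a := ∑ k ∈ U, w k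
  have hexp : HasSum (fun m : ℕ => (m.factorial : ℝ)⁻¹ * b ^ m) (Real.exp b) := by
    rw [Real.exp_eq_exp_ℝ]
    simpa only [smul_eq_mul] using NormedSpace.exp_series_hasSum_exp' (𝕂 := ℝ) b
  -- The differentiated exponential series; its term at `m = 0` vanishes, and shifting the index
  -- returns the original series.
  have hexp' : HasSum (fun m : ℕ => (m.factorial : ℝ)⁻¹ * (m * b ^ (m - 1))) (Real.exp b) := by
    rw [← hasSum_nat_add_iff' 1]
    simp only [Finset.sum_range_one, Nat.cast_zero, zero_mul, mul_zero, sub_zero,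
      Nat.add_sub_cancel]
    refine hexp.congr_fun fun m => ?_
    rw [Nat.factorial_succ]
    push_cast
    field_simp
  have hl := ((hexp.mul_right s).sub (hexp'.mul_right a)).mul_left (Real.exp (-n))
  have hr := (hasSum_sum (s := Finset.univ) fun y _ =>
    hasSum_budgetKernel (U := U) (w := w) hP s x y).mul_left s
  refine le_trans (le_of_eq ?_) (hasSum_le (fun m => ?_) hl hr)
  · rw [neg_sub, sub_eq_neg_add, Real.exp_add]
    ring
  · rw [← Finset.mul_sum, ← Finset.mul_sum]
    have h := le_sum_budgetSum (U := U) hP hw m s le_rfl x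
    refine le_trans (le_of_eq ?_) (le_trans (mul_le_mul_of_nonneg_left h
      (by positivity : 0 ≤ Real.exp (-n) * (m.factorial : ℝ)⁻¹)) (le_of_eq ?_))
    · ring
    · ring

end Insertion

/-! ### Local stability of the Ising chain -/

section LocalStability

variable {n : ℕ} {A : Matrix (Fin n) (Fin n) ℝ} {P : Fin n → Matrix (Config n) (Config n) ℝ}
  {U : Finset (Fin n)} {w : Fin n → ℝ} {γ κ : ℝ} {i j : Fin n}

/-- Flipping the spin at `i` changes the environment of `k ≠ i` at one site only, so the sum in
`γ`-boundedness reduces to `|A k i|`. -/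
lemma IsBounded.isFlipStable (hb : IsBounded A P γ) (hP : IsSingleSite P) (hγ : 0 ≤ γ)
    (hi : i ∉ U) (hw : ∀ k, |A k i| ≤ w k) : IsFlipStable P U w γ (negAt i) := by
  intro k hk x y
  have hki : k ≠ i := fun h => hi (h ▸ hk)
  by_cases hxy : ∃ l, l ≠ k ∧ y l ≠ x l
  · rw [hP.single_site k x y hxy, mul_zero]
    exact hP.nonneg _ _ _
  push Not at hxy
  have hε : ∀ l, l ≠ i → (negAt i : Config n) l = 1 := fun l hl => by simp [negAt, hl]
  have hset : ∀ z, (∀ l, l ≠ k → z l = x l) → z = setSite x k (z k) := fun z hz =>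
    Function.eq_update_iff.2 ⟨rfl, hz⟩
  have hset' : negAt i * y = setSite (negAt i * x) k (y k) := by
    refine Function.eq_update_iff.2 ⟨?_, fun l hl => ?_⟩
    · rw [Pi.mul_apply, hε k hki, one_mul]
    · rw [Pi.mul_apply, Pi.mul_apply, hxy l hl]
  have h := hb k x (negAt i * x) (y k) (by rw [Pi.mul_apply, hε k hki, one_mul])
  rw [← hset', ← hset y hxy] at h
  have hsum : ∑ l ∈ Finset.univ.filter (fun l => x l ≠ (negAt i * x) l), |A k l| ≤ w k := by
    refine le_trans (Finset.sum_le_sum_of_subset_of_nonneg (t := {i}) (fun l hl => ?_)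
      fun l _ _ => abs_nonneg _) (by simpa using hw k)
    rw [Finset.mem_filter] at hl
    by_contra hli
    rw [Finset.mem_singleton] at hli
    exact hl.2 (by rw [Pi.mul_apply, hε l hli, one_mul])
  have h2 : P k x y ≤ Real.exp (γ * w k) * P k (negAt i * x) (negAt i * y) :=
    h.trans (mul_le_mul_of_nonneg_right
      (Real.exp_le_exp.2 (mul_le_mul_of_nonneg_left hsum hγ)) (hP.nonneg _ _ _))
  rw [Real.exp_neg, inv_mul_le_iff₀ (Real.exp_pos _)]
  exact h2

lemma setPair_apply_left (hij : i ≠ j) (y : Config n) (a b : ℤˣ) : setPair y i j a b i = a := by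
  simp [setPair, setSite, hij]

lemma setPair_apply_right (y : Config n) (a b : ℤˣ) : setPair y i j a b j = b := by
  simp [setPair, setSite]

lemma setPair_apply_of_ne (y : Config n) (a b : ℤˣ) {k : Fin n} (hi : k ≠ i) (hj : k ≠ j) :
    setPair y i j a b k = y k := by
  simp [setPair, setSite, hi, hj]

lemma setPair_setPair (hij : i ≠ j) (y : Config n) (a b a' b' : ℤˣ) :
    setPair (setPair y i j a b) i j a' b' = setPair y i j a' b' := by
  funext k
  rcases eq_or_ne k j with rfl | hj
  · simp only [setPair_apply_right]
  rcases eq_or_ne k i with rfl | hi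
  · simp only [setPair_apply_left hij]
  · simp only [setPair_apply_of_ne _ _ _ hi hj]

lemma setPair_eq_self {y : Config n} {a b : ℤˣ} (ha : y i = a) (hb : y j = b) :
    setPair y i j a b = y := by
  subst ha hb
  simp [setPair, setSite]

/-- The spins at `i` and `j` each agree with those of `x` or are opposite, so the four sign
patterns, which are those produced by the insertions, cover all cases. -/
lemma exists_mul_setPair_eq (hij : i ≠ j) (z x : Config n) :
    ∃ ε : Config n, (ε = 1 ∨ ε = negAt i ∨ ε = negAt j ∨ ε = negAt i * negAt j) ∧
      ε * setPair z i j (x i) (x j) = z := by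
  have hneg : ∀ a b : ℤˣ, a ≠ b → -b = a := fun a b h => (Int.units_ne_iff_eq_neg.1 h).symm
  have hflip : ∀ (k : Fin n) (y : Config n), negAt k * y = Function.update y k (-(y k)) :=
    fun k y => negAt_mul k y
  have key : ∀ ε : Config n, (ε * setPair z i j (x i) (x j)) i = z i →
      (ε * setPair z i j (x i) (x j)) j = z j → (∀ k, k ≠ i → k ≠ j → ε k = 1) →
      ε * setPair z i j (x i) (x j) = z := by
    intro ε h1 h2 h3
    funext k
    rcases eq_or_ne k i with rfl | hi
    · exact h1
    rcases eq_or_ne k j with rfl | hj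
    · exact h2
    rw [Pi.mul_apply, h3 k hi hj, one_mul, setPair_apply_of_ne _ _ _ hi hj]
  by_cases h1 : z i = x i <;> by_cases h2 : z j = x j
  · refine ⟨1, by simp, key _ ?_ ?_ ?_⟩ <;>
      simp [setPair_apply_left hij, setPair_apply_right, h1, h2]
  · refine ⟨negAt j, by simp, key _ ?_ ?_ ?_⟩ <;>
      simp +contextual [negAt, setPair_apply_left hij, setPair_apply_right, h1, hij, hneg _ _ h2]
  · refine ⟨negAt i, by simp, key _ ?_ ?_ ?_⟩ <;>
      simp +contextual [negAt, setPair_apply_left hij, setPair_apply_right, h2, hij.symm,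
        hneg _ _ h1]
  · refine ⟨negAt i * negAt j, by simp, key _ ?_ ?_ ?_⟩ <;>
      simp +contextual [negAt, setPair_apply_left hij, setPair_apply_right, hij, hij.symm,
        hneg _ _ h1, hneg _ _ h2]

/-- The kernel that equals `K` at configurations which agree with the initial one at `i` and `j`,
and is extended to the other settings of these two spins with an additional factor `r`. -/
noncomputable def spread (K : Matrix (Config n) (Config n) ℝ) (i j : Fin n) (r : ℝ) :
    Matrix (Config n) (Config n) ℝ :=
  fun x z => if z i = x i ∧ z j = x j then K x z else r * K x (setPair z i j (x i) (x j))

/-- Both endpoints depend on `z` only through its spins outside `i` and `j`, so the four settings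
have masses within the factor `r` of each other. -/
lemma spread_mem_Icc {K : Matrix (Config n) (Config n) ℝ} (hK : ∀ x y, 0 ≤ K x y) {r : ℝ}
    (hr : r ≤ 1) (x z : Config n) :
    spread K i j r x z ∈ Set.Icc (r * K x (setPair z i j (x i) (x j)))
      (K x (setPair z i j (x i) (x j))) := by
  have h := mul_le_of_le_one_left (hK x (setPair z i j (x i) (x j))) hr
  unfold spread
  split_ifs with hz
  · rw [setPair_eq_self hz.1 hz.2] at h ⊢
    exact ⟨h, le_rfl⟩
  · exact ⟨le_rfl, h⟩

lemma isLocallyStable_spread {K : Matrix (Config n) (Config n) ℝ} (hK : ∀ x y, 0 ≤ K x y)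
    (hij : i ≠ j) {r r' : ℝ} (hr0 : 0 ≤ r') (hrr : r' ≤ r) (hr : r ≤ 1) (x : Config n) :
    IsLocallyStable (spread K i j r x) i j r' := by
  intro y a b a' b'
  have h1 := (spread_mem_Icc (i := i) (j := j) hK hr x (setPair y i j a b)).1
  have h2 := (spread_mem_Icc (i := i) (j := j) hK hr x (setPair y i j a' b')).2
  rw [setPair_setPair hij] at h1 h2
  exact (mul_le_mul hrr h2 ((mul_nonneg (hr0.trans hrr) (hK _ _)).trans
    ((setPair_setPair hij y a' b' _ _) ▸ (spread_mem_Icc hK hr x _).1)) (hr0.trans hrr)).trans h1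

/-- Averages of a locally stable kernel that lies below a stochastic matrix. -/
lemma exists_subDistribution_vecMul {Q H : Matrix (Config n) (Config n) ℝ} {r c : ℝ}
    (hQ : ∀ x y, 0 ≤ Q x y) (hQH : ∀ x y, Q x y ≤ H x y) (hH : ∀ x, ∑ y, H x y = 1)
    (hst : ∀ x, IsLocallyStable (Q x) i j r) (hc : ∀ x, c ≤ ∑ y, Q x y)
    {μ : Config n → ℝ} (hμ : μ ∈ stdSimplex ℝ (Config n)) :
    IsSubDistribution (μ ᵥ* Q) ∧ (∀ y, (μ ᵥ* Q) y ≤ (μ ᵥ* H) y) ∧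
      IsLocallyStable (μ ᵥ* Q) i j r ∧ c ≤ ∑ y, (μ ᵥ* Q) y := by
  have happ : ∀ (B : Matrix (Config n) (Config n) ℝ) y, (μ ᵥ* B) y = ∑ x, μ x * B x y :=
    fun _ _ => rfl
  have hsum : ∀ B : Matrix (Config n) (Config n) ℝ,
      ∑ y, (μ ᵥ* B) y = ∑ x, μ x * ∑ y, B x y := by
    intro B
    simp_rw [happ, Finset.mul_sum]
    exact Finset.sum_comm
  have hle : ∀ y, (μ ᵥ* Q) y ≤ (μ ᵥ* H) y := fun y =>
    Finset.sum_le_sum fun x _ => mul_le_mul_of_nonneg_left (hQH x y) (hμ.1 x)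
  refine ⟨⟨fun y => Finset.sum_nonneg fun x _ => mul_nonneg (hμ.1 x) (hQ x y), ?_⟩, hle, ?_, ?_⟩
  · refine (Finset.sum_le_sum fun y _ => hle y).trans (le_of_eq ?_)
    simp_rw [hsum, hH, mul_one]
    exact hμ.2
  · intro y a b a' b'
    rw [happ, happ, Finset.mul_sum]
    refine Finset.sum_le_sum fun x _ => ?_
    rw [mul_left_comm]
    exact mul_le_mul_of_nonneg_left (hst x y a b a' b') (hμ.1 x)
  · rw [hsum]
    calc c = ∑ x, μ x * c := by rw [← Finset.sum_mul, hμ.2, one_mul]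
      _ ≤ _ := Finset.sum_le_sum fun x _ => mul_le_mul_of_nonneg_left (hc x) (hμ.1 x)

lemma transition_mem_stdSimplex (hP : IsSingleSite P) {t : ℝ} (ht : 0 ≤ t) (x : Config n) :
    transition P t x ∈ stdSimplex ℝ (Config n) :=
  ⟨transition_nonneg hP ht x, sum_transition hP t x⟩

lemma vecMul_mem_stdSimplex {H : Matrix (Config n) (Config n) ℝ}
    (hH : ∀ x, H x ∈ stdSimplex ℝ (Config n)) {μ : Config n → ℝ}
    (hμ : μ ∈ stdSimplex ℝ (Config n)) : μ ᵥ* H ∈ stdSimplex ℝ (Config n) := by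
  refine ⟨fun y => Finset.sum_nonneg fun x _ => mul_nonneg (hμ.1 x) ((hH x).1 y), ?_⟩
  calc ∑ y, ∑ x, μ x * H x y = ∑ x, ∑ y, μ x * H x y := Finset.sum_comm
    _ = 1 := by simp_rw [← Finset.mul_sum, (hH _).2, mul_one]; exact hμ.2

lemma le_one_of_flip_lower (hP : IsSingleSite P) (i : Fin n) (hκ : ∀ x, κ ≤ P i x (flip x i)) :
    κ ≤ 1 := by
  refine (hκ 1).trans ?_
  rw [← hP.row_sum i 1]
  exact Finset.single_le_sum (f := fun y => P i 1 y) (fun y _ => hP.nonneg i 1 y)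
    (Finset.mem_univ _)

/-- The width controls rows; symmetry transfers the bound to the column of influences on and from
`i`. -/
lemma IsingAssumption.sum_abs_le {h : Fin n → ℝ} {d : ℕ} {lam α : ℝ}
    (hA : IsingAssumption A h d lam α) (hi : i ∉ U) : ∑ k ∈ U, |A k i| ≤ lam := by
  have h1 : ∑ k ∈ U, |A k i| ≤ ∑ k ∈ Finset.univ.erase i, |A i k| := by
    simp_rw [fun k => hA.symm.apply i k]
    exact Finset.sum_le_sum_of_subset_of_nonneg (fun k hk => Finset.mem_erase.2
      ⟨fun hki => hi (hki ▸ hk), Finset.mem_univ k⟩) fun k _ _ => abs_nonneg _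
  linarith [hA.width i, abs_nonneg (h i)]

/-- The kernel `spread (budgetKernel …)` lies below the transition matrix at time one. -/
lemma spread_budgetKernel_le_transition (hP : IsSingleSite P) (hw : ∀ k, 0 ≤ w k) (hγ : 0 ≤ γ)
    (hκ0 : 0 ≤ κ) (hij : i ≠ j) (hi : i ∉ U) (hj : j ∉ U) (hκ : ∀ k x, κ ≤ P k x (flip x k))
    (hfi : IsFlipStable P U w γ (negAt i)) (hfj : IsFlipStable P U w γ (negAt j))
    {s : ℝ} (hs : 0 ≤ s) (x y : Config n) :
    spread (budgetKernel P U w s) i j (κ ^ 2 * Real.exp (-(2 * γ * s))) x y ≤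
      transition P 1 x y := by
  have hκ1 := le_one_of_flip_lower hP i (hκ i)
  have h0 : ∀ y, 1 * budgetKernel P U w s x y ≤ transition P 1 x y := fun y =>
    mul_budgetKernel_le_transition hP 0 fun m => by
      simpa using budgetSum_le_jump_pow hP m s x y
  have h1 : ∀ k, k ∉ U → IsFlipStable P U w γ (negAt k) → ∀ y,
      κ * Real.exp (-(γ * s)) * budgetKernel P U w s x y ≤ transition P 1 x (negAt k * y) :=
    fun k hk hf y => mul_budgetKernel_le_transition hP 1 fun m => by
      refine le_trans (le_of_eq ?_) (le_jump_pow_succ_negAt_mul hP hw hγ hκ0 hk (hκ k) hf m s x y)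
      rw [Nat.descFactorial_one]
      push_cast
      ring
  have h2 : ∀ y, κ ^ 2 * Real.exp (-(2 * γ * s)) * budgetKernel P U w s x y ≤
      transition P 1 x (negAt i * negAt j * y) :=
    fun y => mul_budgetKernel_le_transition hP 2 fun m => by
      refine le_trans (le_of_eq ?_)
        (le_jump_pow_add_two_negAt_mul hP hw hγ hκ0 hij hi hj hκ hfi hfj m s x y)
      have hd : (m + 2).descFactorial 2 = (m + 2) * (m + 1) := by
        simp [Nat.descFactorial_succ, mul_comm]
      rw [hd]
      push_cast
      ring
  have he : Real.exp (-(2 * γ * s)) ≤ Real.exp (-(γ * s)) :=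
    Real.exp_le_exp.2 (by nlinarith [mul_nonneg hγ hs])
  -- As `κ ≤ 1`, the factor for two flips also serves for a single one.
  have hr1 : κ ^ 2 * Real.exp (-(2 * γ * s)) ≤ κ * Real.exp (-(γ * s)) :=
    mul_le_mul (by nlinarith) he (Real.exp_pos _).le hκ0
  have hK := budgetKernel_nonneg (U := U) (w := w) hP s x (setPair y i j (x i) (x j))
  unfold spread
  split_ifs with hz
  · simpa using h0 y
  obtain ⟨ε, hε, hy⟩ := exists_mul_setPair_eq hij y x
  rcases hε with rfl | rfl | rfl | rfl
  · rw [one_mul] at hy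
    refine absurd ⟨?_, ?_⟩ hz
    · rw [← hy, setPair_apply_left hij]
    · rw [← hy, setPair_apply_right]
  · have := h1 i hi hfi (setPair y i j (x i) (x j))
    rw [hy] at this
    exact (mul_le_mul_of_nonneg_right hr1 hK).trans this
  · have := h1 j hj hfj (setPair y i j (x i) (x j))
    rw [hy] at this
    exact (mul_le_mul_of_nonneg_right hr1 hK).trans this
  · have := h2 (setPair y i j (x i) (x j))
    rwa [hy] at this

/-- Words that avoid `i` and `j` freeze these spins, so `budgetKernel` is supported where `spread`
leaves it unchanged. -/
lemma sum_budgetKernel_le_sum_spread (hP : IsSingleSite P) (hi : i ∉ U) (hj : j ∉ U) {r : ℝ}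
    (hr : 0 ≤ r) (s : ℝ) (x : Config n) :
    ∑ y, budgetKernel P U w s x y ≤ ∑ y, spread (budgetKernel P U w s) i j r x y := by
  refine Finset.sum_le_sum fun y _ => ?_
  unfold spread
  split_ifs with hy
  · exact le_rfl
  · have h0 : budgetKernel P U w s x y = 0 := by
      by_cases h : y i = x i
      · exact budgetKernel_eq_zero_of_ne hP hj (fun h' => hy ⟨h, h'⟩) s
      · exact budgetKernel_eq_zero_of_ne hP hi h s
    rw [h0]
    exact mul_nonneg hr (budgetKernel_nonneg hP _ _ _)

/-- Local stability at time one. -/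
lemma exists_locallyStable_le_transition_one {h : Fin n → ℝ} {d : ℕ} {lam α : ℝ}
    (hA : IsingAssumption A h d lam α) (hP : IsSingleSite P) (hγ : 0 ≤ γ)
    (hb : IsBounded A P γ) (hκ0 : 0 < κ) (hκ : ∀ k x, κ ≤ P k x (flip x k)) (hij : i ≠ j) :
    ∃ Q : Matrix (Config n) (Config n) ℝ, (∀ x y, 0 ≤ Q x y) ∧
      (∀ x y, Q x y ≤ transition P 1 x y) ∧
      (∀ x, IsLocallyStable (Q x) i j
        (Real.exp (-2) / 2 * Real.exp (-(8 * (γ * lam))) * κ ^ 4)) ∧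
      ∀ x, Real.exp (-2) / 2 ≤ ∑ y, Q x y := by
  set U : Finset (Fin n) := {i, j}ᶜ with hU
  set w : Fin n → ℝ := fun k => |A k i| + |A k j| with hw_def
  have hi : i ∉ U := by simp [hU]
  have hj : j ∉ U := by simp [hU]
  have hw : ∀ k, 0 ≤ w k := fun k => add_nonneg (abs_nonneg _) (abs_nonneg _)
  have hlam := hA.lam_pos
  have hκ1 := le_one_of_flip_lower hP i (hκ i)
  have hfi : IsFlipStable P U w γ (negAt i) :=
    hb.isFlipStable hP hγ hi fun k => le_add_of_nonneg_right (abs_nonneg _)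
  have hfj : IsFlipStable P U w γ (negAt j) :=
    hb.isFlipStable hP hγ hj fun k => le_add_of_nonneg_left (abs_nonneg _)
  -- The budget `4 * lam` is twice the bound `2 * lam` on the expected weight, so Markov's
  -- inequality keeps half of the mass; two flips at this budget give the constant `8`.
  set r := κ ^ 2 * Real.exp (-(2 * γ * (4 * lam))) with hr
  have hr0 : 0 ≤ r := by positivity
  have hr1 : r ≤ 1 := mul_le_one₀ (pow_le_one₀ hκ0.le hκ1) (Real.exp_pos _).le
    (Real.exp_le_one_iff.2 (neg_nonpos.2 (by positivity)))
  have hK := budgetKernel_nonneg (U := U) (w := w) hP (4 * lam)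
  refine ⟨spread (budgetKernel P U w (4 * lam)) i j r, fun x y => ?_, fun x y => ?_, fun x => ?_,
    fun x => ?_⟩
  · exact (mul_nonneg hr0 (hK _ _)).trans (spread_mem_Icc hK hr1 x y).1
  · exact spread_budgetKernel_le_transition hP hw hγ hκ0.le hij hi hj hκ hfi hfj
      (by positivity) x y
  · refine isLocallyStable_spread hK hij (by positivity) ?_ hr1 x
    have hc : Real.exp (-2) / 2 ≤ 1 := by
      linarith [Real.exp_le_one_iff.2 (by norm_num : (-2 : ℝ) ≤ 0)]
    have he : Real.exp (-(8 * (γ * lam))) = Real.exp (-(2 * γ * (4 * lam))) := by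
      congr 1; ring
    rw [hr, he, mul_comm, ← mul_assoc]
    refine mul_le_mul_of_nonneg_right ?_ (Real.exp_pos _).le
    have h4 : κ ^ 4 ≤ κ ^ 2 := pow_le_pow_of_le_one hκ0.le hκ1 (by norm_num)
    exact (mul_le_of_le_one_right (by positivity) hc).trans h4
  · refine le_trans ?_ (sum_budgetKernel_le_sum_spread hP hi hj hr0 _ x)
    have hmass := le_sum_budgetKernel (U := U) hP hw (4 * lam) x
    have hcard : (n : ℝ) - #U = 2 := by
      have h2 := Finset.card_add_card_compl ({i, j} : Finset (Fin n))
      rw [Finset.card_pair hij, Fintype.card_fin] at h2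
      have h3 : (2 : ℝ) + #U = n := by exact_mod_cast h2
      linarith
    have hsum : ∑ k ∈ U, w k ≤ 2 * lam := by
      rw [hw_def, Finset.sum_add_distrib]
      linarith [hA.sum_abs_le hi, hA.sum_abs_le hj]
    rw [hcard] at hmass
    have h3 : Real.exp (-2) * (2 * lam) ≤ Real.exp (-2) * (4 * lam - ∑ k ∈ U, w k) :=
      mul_le_mul_of_nonneg_left (by linarith) (Real.exp_pos _).le
    refine le_of_mul_le_mul_left ?_ (by positivity : 0 < 4 * lam)
    linarith

end LocalStability

end IsingDynamics

open IsingDynamics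
theorem mainTheorem6 :
    ∃ c : ℝ, 0 < c ∧ ∃ C : ℝ, 0 < C ∧
      ∀ (n : ℕ) (A : Matrix (Fin n) (Fin n) ℝ) (h : Fin n → ℝ)
        (P : Fin n → Matrix (Config n) (Config n) ℝ)
        (d : ℕ) (lam α δ₀ : ℝ) (η : ℝ → ℝ) (γ κ : ℝ),
        IsingAssumption A h d lam α →
        ChainAssumption A h P lam α δ₀ η γ κ →
        ∀ i j : Fin n, i ≠ j → ∀ t : ℝ, 1 ≤ t →
          -- the transition matrix at time `t` (in particular at time `1`)
          (∃ Q : Matrix (Config n) (Config n) ℝ,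
            (∀ x, IsSubDistribution (Q x)) ∧
            (∀ x y, Q x y ≤ transition P t x y) ∧
            (∀ x, IsLocallyStable (Q x) i j (c * Real.exp (-(C * (γ * lam))) * κ ^ 4)) ∧
            (∀ x, c ≤ ∑ y, Q x y)) ∧
          -- the law at time `t` from a random initial configuration
          (∀ D : Config n → ℝ, D ∈ stdSimplex ℝ (Config n) →
            ∃ q : Config n → ℝ,
              IsSubDistribution q ∧
              (∀ y, q y ≤ lawAt P D t y) ∧
              IsLocallyStable q i j (c * Real.exp (-(C * (γ * lam))) * κ ^ 4) ∧
              c ≤ ∑ y, q y) := by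
  refine ⟨Real.exp (-2) / 2, by positivity, 8, by norm_num, ?_⟩
  intro n A h P d lam α δ₀ η γ κ hA hC i j hij t ht
  have hP := hC.singleSite
  obtain ⟨Q, hQ0, hQH, hQst, hQc⟩ := exists_locallyStable_le_transition_one hA hP hC.γ_nonneg
    hC.bounded hC.κ_pos hC.flip_lower hij
  have main := fun (μ : Config n → ℝ) (hμ : μ ∈ stdSimplex ℝ (Config n)) =>
    exists_subDistribution_vecMul hQ0 hQH (sum_transition hP 1) hQst hQc hμ
  have hH : ∀ x, transition P (t - 1) x ∈ stdSimplex ℝ (Config n) :=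
    transition_mem_stdSimplex hP (by linarith)
  -- Only the last unit of time is used: the law at time `t - 1` is an arbitrary distribution over
  -- which the kernel `Q` is averaged.
  have hmul : transition P t = transition P (t - 1) * transition P 1 := by
    rw [← transition_add, sub_add_cancel]
  refine ⟨⟨fun x => Matrix.vecMul (transition P (t - 1) x) Q, fun x => (main _ (hH x)).1,
    fun x y => ?_, fun x => (main _ (hH x)).2.2.1, fun x => (main _ (hH x)).2.2.2⟩,
    fun D hD => ?_⟩
  · rw [hmul]
    exact (main _ (hH x)).2.1 y
  · have h := main _ (vecMul_mem_stdSimplex hH hD)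
    refine ⟨_, h.1, fun y => ?_, h.2.2⟩
    rw [lawAt, hmul, ← Matrix.vecMul_vecMul]
    exact h.2.1 y
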